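/- **Proposition (finite-grid existence of the selected-equilibrium construction).** Let $N,T$ be integers with $1\le T<N$, let $\bar v,\eta\in\mathbb R$ and $s:\mathbb R\to\mathbb R$, and put $\tau=T/N$. Let $F_{x\mid z=1}$ be the distribution function of a probability law on $\mathbb R$, let $f(m\mid\theta)$ $(m\in\mathbb R,\ \theta\in[0,1])$ be a family of probability densities in $m$, and let $\nu$ be a Borel probability measure (the prior of $\theta$) on $[0,1]$. Suppose that $F_{x\mid z=1}$ is continuous and that $f(m\mid\theta)$ is continuous in $(m,\theta)$. Fix a grid $m_1<\dots<m_K$, a quadrature rule $\int g(m)\,dm\approx\sum_k w_k g(m_k)$ with real weights $w_k$ (constants or, for a renormalized rule, continuous functions of $\theta$), numbers $\varepsilon>0$ and $0<X<\infty$, and projection weights $\omega_1,\dots,\omega_K>0$. Let $$\mathcal C_K(X)=\{x\in[-X,X]^K: x_1\ge\dots\ge x_K\}.$$ For a cutoff vector $x\in\mathbb R^K$ put $$\alpha_x(\theta)=\theta\sum_{k=1}^K w_k\,[1-F_{x\mid z=1}(x_k)]\,f(m_k\mid\theta),$$ $$b_j(a)=\binom{N-1}{j}a^j(1-a)^{N-1-j},\qquad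 E[g(\theta)\mid m]=\frac{\int g(\theta)f(m\mid\theta)\,d\nu(\theta)}{\int f(m\mid\theta)\,d\nu(\theta)},$$ where the last quotient is read as $0$ if its denominator is $0$. Put $piv_k(x)=E[b_{T-1}(\alpha_x(\theta))\mid m_k]$, $p_{+,k}(x)=E\bigl[\sum_{j=T-1}^{N-1}b_j(\alpha_x(\theta))\mid m_k\bigr]$ and $p_{0,k}(x)=E\bigl[\sum_{j=T}^{N-1}b_j(\alpha_x(\theta))\mid m_k\bigr]$. Let the raw best response be $$\widetilde B_{T,\varepsilon,X}(x)_k=\operatorname{clip}_{[-X,X]}\left(-\frac{piv_k(x)\,\bar v+p_{0,k}(x)\,s(\tau)+\eta}{\max\{p_{+,k}(x),\varepsilon\}}\right),$$ and let $B_{T,\varepsilon,X}(x)$ be the weighted isotonic projection of $\widetilde B_{T,\varepsilon,X}(x)$, i.e. the unique minimizer over $z\in\mathcal C_K(X)$ of $\sum_k\omega_k\bigl(\widetilde B_{T,\varepsilon,X}(x)_k-z_k\bigr)^2$. Then $B_{T,\varepsilon,X}$ is continuous on $\mathcal C_K(X)$ and maps $\mathcal C_K(X)$ into itself; the set $\mathcal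 C_K(X)$ is nonempty, compact and convex; and $B_{T,\varepsilon,X}$ has at least one fixed point $x^{*,K}(T)\in\mathcal C_K(X)$. -/

import Mathlib

open MeasureTheory unitInterval

namespace SelectedGrid

/-- Data of the finite-`N` benchmark: eligible population `N`, threshold `T`, common success
value `vbar`, stigma schedule `s`, net signing utility `eta`, law of the reputational type of a
supportive agent, signal density `f m θ = f(m ∣ θ)` and prior over the support state `θ ∈ [0,1]`. -/
structure Benchmark where
  N : ℕ
  T : ℕ
  vbar : ℝ
  s : ℝ → ℝ
  eta : ℝ
  typeLaw : Measure ℝ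
  f : ℝ → I → ℝ
  prior : Measure I

/-- Data of the discretization: signal grid `m`, weights of the quadrature rule in the signal
(`∫ g(m) dm ≈ ∑ k, w k θ * g (m k)`; a fixed rule has weights constant in `θ`, a rule renormalized
to unit signal mass has weights depending on `θ`), trim `eps`, cutoff bound `X`, and the weights
`omega` of the isotonic least-squares projection. -/
structure Discretization (K : ℕ) where
  m : Fin K → ℝ
  w : Fin K → I → ℝ
  eps : ℝ
  X : ℝ
  omega : Fin K → ℝ

noncomputable section

/-- The binomial point mass `Pr(M = j)`, `M ∼ Binomial(n, a)`. -/
def binomPoint (n j : ℕ) (a : ℝ) : ℝ := (n.choose j : ℝ) * a ^ j * (1 - a) ^ (n - j)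

/-- The binomial upper tail `Pr(M ≥ t)`, `M ∼ Binomial(n, a)`. -/
def binomTail (n t : ℕ) (a : ℝ) : ℝ := ∑ j ∈ Finset.Icc t n, binomPoint n j a

variable {K : ℕ}

/-- The bounded monotone cone `{x ∈ [-X, X]^K : x₁ ≥ ⋯ ≥ x_K}`. -/
def cone (K : ℕ) (X : ℝ) : Set (Fin K → ℝ) :=
  {x | (∀ k, x k ∈ Set.Icc (-X) X) ∧ Antitone x}

/-- The distribution function of the reputational type of a supportive agent. -/
def Benchmark.F (b : Benchmark) (y : ℝ) : ℝ := ProbabilityTheory.cdf b.typeLaw y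

/-- Quadrature value of `α(θ) = θ ∫ [1 - F(x(m))] f(m ∣ θ) dm` at a cutoff vector `x`. -/
def signProb (b : Benchmark) (d : Discretization K) (x : Fin K → ℝ) (θ : I) : ℝ :=
  (θ : ℝ) * ∑ k, d.w k θ * ((1 - b.F (x k)) * b.f (d.m k) θ)

/-- The posterior expectation `E[g(θ) ∣ m]`, by Bayes' rule. -/
def posteriorMean (b : Benchmark) (g : I → ℝ) (m : ℝ) : ℝ :=
  (∫ θ, g θ * b.f m θ ∂b.prior) / ∫ θ, b.f m θ ∂b.prior

/-- `E[Pr(M₋ᵢ = T - 1 ∣ θ) ∣ m_k]`. -/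
def piv (b : Benchmark) (d : Discretization K) (x : Fin K → ℝ) (k : Fin K) : ℝ :=
  posteriorMean b (fun θ => binomPoint (b.N - 1) (b.T - 1) (signProb b d x θ)) (d.m k)

/-- `E[Pr(M₋ᵢ ≥ T - 1 ∣ θ) ∣ m_k]`. -/
def pPlus (b : Benchmark) (d : Discretization K) (x : Fin K → ℝ) (k : Fin K) : ℝ :=
  posteriorMean b (fun θ => binomTail (b.N - 1) (b.T - 1) (signProb b d x θ)) (d.m k)

/-- `E[Pr(M₋ᵢ ≥ T ∣ θ) ∣ m_k]`. -/
def pZero (b : Benchmark) (d : Discretization K) (x : Fin K → ℝ) (k : Fin K) : ℝ :=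
  posteriorMean b (fun θ => binomTail (b.N - 1) b.T (signProb b d x θ)) (d.m k)

/-- Clipping of a real number to `[-X, X]`. -/
def clip (X y : ℝ) : ℝ := max (-X) (min X y)

/-- The raw best response: the cutoff identity on the grid with trimmed denominator, clipped. -/
def rawResponse (b : Benchmark) (d : Discretization K) (x : Fin K → ℝ) : Fin K → ℝ := fun k =>
  clip d.X
    (-(piv b d x k * b.vbar + pZero b d x k * b.s ((b.T : ℝ) / (b.N : ℝ)) + b.eta) /
      max (pPlus b d x k) d.eps)

/-- Weighted squared distance. -/
def wdist (omega y z : Fin K → ℝ) : ℝ := ∑ k, omega k * (y k - z k) ^ 2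

/-- `z` is a weighted least-squares projection of `y` onto the bounded monotone cone. -/
def IsIsotonicProj (omega : Fin K → ℝ) (X : ℝ) (y z : Fin K → ℝ) : Prop :=
  z ∈ cone K X ∧ ∀ z' ∈ cone K X, wdist omega y z ≤ wdist omega y z'

/-- The weighted isotonic projection onto the bounded monotone cone. -/
def isotonicProj (omega : Fin K → ℝ) (X : ℝ) (y : Fin K → ℝ) : Fin K → ℝ :=
  Classical.epsilon (IsIsotonicProj omega X y)

/-- The projected best-response operator. -/
def projResponse (b : Benchmark) (d : Discretization K) (x : Fin K → ℝ) : Fin K → ℝ :=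
  isotonicProj d.omega d.X (rawResponse b d x)

/-- The weighted isotonic projection is well defined. -/
theorem existsUnique_isotonicProj (omega : Fin K → ℝ) (homega : ∀ k, 0 < omega k)
    {X : ℝ} (hX : 0 < X) (y : Fin K → ℝ) : ∃! z, IsIsotonicProj omega X y z := by
  have hcl : IsClosed {x : Fin K → ℝ | Antitone x} := by
    have : {x : Fin K → ℝ | Antitone x} = ⋂ i, ⋂ j, ⋂ (_ : i ≤ j), {x | x j ≤ x i} := by
      ext x
      simp [Antitone]
    rw [this]
    exact isClosed_iInter fun i => isClosed_iInter fun j => isClosed_iInter fun _ =>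
      isClosed_le (continuous_apply j) (continuous_apply i)
  have hcpt : IsCompact (cone K X) := by
    have h1 : IsCompact (Set.pi Set.univ fun _ : Fin K => Set.Icc (-X) X) :=
      isCompact_univ_pi fun _ => isCompact_Icc
    have : cone K X = (Set.pi Set.univ fun _ : Fin K => Set.Icc (-X) X) ∩ {x | Antitone x} := by
      ext x
      simp only [cone, Set.mem_ofPred_eq, Set.mem_inter_iff, Set.mem_pi, Set.mem_univ, true_imp_iff]
    rw [this]
    exact h1.inter_right hcl
  have hne : (cone K X).Nonempty :=
    ⟨fun _ => 0, fun _ => ⟨by linarith, by linarith⟩, fun _ _ _ => le_rfl⟩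
  have hcont : Continuous (wdist omega y) := by
    unfold wdist
    fun_prop
  obtain ⟨z, hz, hmin⟩ := hcpt.exists_isMinOn hne hcont.continuousOn
  refine ⟨z, ⟨hz, fun z' hz' => hmin hz'⟩, ?_⟩
  rintro u ⟨hu, humin⟩
  have hmid : (fun k => (u k + z k) / 2) ∈ cone K X := by
    refine ⟨fun k => ?_, fun i j hij => ?_⟩
    · have h1 := hu.1 k
      have h2 := hz.1 k
      exact ⟨by linarith [h1.1, h2.1], by linarith [h1.2, h2.2]⟩
    · have h1 := hu.2 hij
      have h2 := hz.2 hij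
      show (u j + z j) / 2 ≤ (u i + z i) / 2
      linarith
  have h1 := humin _ hmid
  have h2 : wdist omega y z ≤ wdist omega y (fun k => (u k + z k) / 2) := hmin hmid
  have hpar : wdist omega y (fun k => (u k + z k) / 2) =
      (wdist omega y u + wdist omega y z) / 2 - (∑ k, omega k * (u k - z k) ^ 2) / 4 := by
    unfold wdist
    rw [← Finset.sum_add_distrib, Finset.sum_div, Finset.sum_div, ← Finset.sum_sub_distrib]
    exact Finset.sum_congr rfl fun k _ => by ring
  have hnn : ∀ k ∈ Finset.univ, 0 ≤ omega k * (u k - z k) ^ 2 := fun k _ =>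
    mul_nonneg (homega k).le (sq_nonneg _)
  have hzero : ∑ k, omega k * (u k - z k) ^ 2 = 0 :=
    le_antisymm (by linarith) (Finset.sum_nonneg hnn)
  funext k
  have hk := (Finset.sum_eq_zero_iff_of_nonneg hnn).1 hzero k (Finset.mem_univ k)
  have := (mul_eq_zero.1 hk).resolve_left (homega k).ne'
  exact sub_eq_zero.1 (pow_eq_zero_iff (two_ne_zero)|>.1 this)

/-- The operator `isotonicProj` is that projection. -/
theorem isotonicProj_spec (omega : Fin K → ℝ) (homega : ∀ k, 0 < omega k)
    {X : ℝ} (hX : 0 < X) (y : Fin K → ℝ) :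
    IsIsotonicProj omega X y (isotonicProj omega X y) :=
  Classical.epsilon_spec (existsUnique_isotonicProj omega homega hX y).exists

end

end SelectedGrid

/-! The operator is continuous on all of `Fin K → ℝ` and takes every vector into the cone. Brouwer's
theorem for a bounded continuous map of the whole space therefore suffices, and the fixed point lies
in the cone because it is a value of the operator. Continuity of the raw response: the integrands
are jointly continuous on a compact state space, and the trim keeps the varying denominator at least
`eps`. Continuity of the projection: a unique minimizer over a compact set depends continuously on
the data. Brouwer is proved by volume. For a `C¹` map `1 + h` of the ball fixing the sphere, `1 + t
h` is a bijection of the open ball for small `t ≥ 0`, so its Jacobian integrates to the volume; the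
integral is polynomial in `t`, so this persists at `t = 1`. A retraction onto the sphere has zero
Jacobian, a contradiction. -/

section Brouwer

/-! ### Brouwer's fixed point theorem -/

open Metric Set Filter Topology

variable {E : Type*} [NormedAddCommGroup E] [InnerProductSpace ℝ E] [FiniteDimensional ℝ E]

/-- A perturbation of the identity by an operator of norm less than one has positive determinant. -/
theorem det_one_add_pos_of_norm_lt_one (A : E →L[ℝ] E) (hA : ‖A‖ < 1) :
    0 < (1 + A : E →L[ℝ] E).det := by
  -- A kernel vector would satisfy `‖v‖ = s * ‖A v‖ < ‖v‖`. The determinant thus never vanishes on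
  -- the segment from `1` to `1 + A`, and it starts at `1`.
  have hne : ∀ s ∈ Icc (0 : ℝ) 1, (1 + s • A : E →L[ℝ] E).det ≠ 0 := by
    intro s hs h0
    obtain ⟨v, hv, hv0⟩ :=
      (Submodule.ne_bot_iff _).1 (LinearMap.bot_lt_ker_of_det_eq_zero h0).ne'
    have h1 : v + s • A v = 0 := hv
    have h2 : ‖v‖ = s * ‖A v‖ := by
      rw [eq_neg_of_add_eq_zero_left h1, norm_neg, norm_smul, Real.norm_of_nonneg hs.1,
        ← eq_neg_of_add_eq_zero_left h1]
    have h3 : 0 < ‖v‖ := norm_pos_iff.2 hv0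
    nlinarith [A.le_opNorm v, hs.1, hs.2, norm_nonneg (A v), norm_nonneg A]
  have hc : Continuous fun s : ℝ => (1 + s • A : E →L[ℝ] E).det :=
    ContinuousLinearMap.continuous_det.comp (by fun_prop)
  by_contra! hneg
  have h1 : (0 : ℝ) ∈ Icc ((1 + (1 : ℝ) • A : E →L[ℝ] E).det)
      ((1 + (0 : ℝ) • A : E →L[ℝ] E).det) := by
    refine ⟨by simpa using hneg, ?_⟩
    rw [zero_smul, add_zero]
    simp [ContinuousLinearMap.det]
  obtain ⟨s, hs, h0⟩ := intermediate_value_Icc' zero_le_one hc.continuousOn h1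
  exact hne s hs h0

/-- The determinant of `1 + t A` is a polynomial in `t` of degree at most the dimension. -/
theorem exists_polynomial_det_one_add_smul (A : E →L[ℝ] E) :
    ∃ p : Polynomial ℝ, p.degree < (Module.finrank ℝ E + 1 : ℕ) ∧
      ∀ t : ℝ, (1 + t • A : E →L[ℝ] E).det = p.eval t := by
  let b := Module.finBasis ℝ E
  let M := LinearMap.toMatrix b b A.toLinearMap
  refine ⟨((Polynomial.X : Polynomial ℝ) • M.map Polynomial.C +
    (1 : Matrix (Fin _) (Fin _) ℝ).map Polynomial.C).det, ?_, fun t => ?_⟩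
  · refine (Polynomial.degree_le_of_natDegree_le
      (Polynomial.natDegree_det_X_add_C_le M 1)).trans_lt ?_
    rw [Fintype.card_fin]
    exact_mod_cast Nat.lt_succ_self _
  · have h1 : (1 + t • A : E →L[ℝ] E).det = (1 + t • M).det := by
      rw [ContinuousLinearMap.det, ← LinearMap.det_toMatrix b]
      congr 1
      rw [ContinuousLinearMap.toLinearMap_add, ContinuousLinearMap.toLinearMap_smul, map_add,
        map_smul]
      congr 1
      exact LinearMap.toMatrix_one b
    rw [h1, ← Polynomial.coe_evalRingHom, RingHom.map_det]
    congr 1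
    ext i j
    simp only [RingHom.mapMatrix_apply, Matrix.map_apply, Matrix.add_apply, Matrix.smul_apply,
      smul_eq_mul, Polynomial.coe_evalRingHom, Polynomial.eval_add, Polynomial.eval_mul,
      Polynomial.eval_X, Polynomial.eval_C]
    exact add_comm _ _

variable {h : E → E}

/-- A map that is `C¹` near the closed unit ball is Lipschitz there, with bounded derivative. -/
theorem exists_lipschitz_of_contDiffAt_closedBall
    (hd : ∀ x ∈ closedBall (0 : E) 1, ContDiffAt ℝ 1 h x) :
    ∃ C : ℝ, 0 < C ∧ (∀ x ∈ closedBall (0 : E) 1, ‖fderiv ℝ h x‖ ≤ C) ∧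
      ∀ x ∈ closedBall (0 : E) 1, ∀ y ∈ closedBall (0 : E) 1, ‖h y - h x‖ ≤ C * ‖y - x‖ := by
  have hc : ContinuousOn (fderiv ℝ h) (closedBall (0 : E) 1) := fun x hx =>
    ((hd x hx).continuousAt_fderiv one_ne_zero).continuousWithinAt
  obtain ⟨C, hC⟩ := (isCompact_closedBall (0 : E) 1).exists_bound_of_continuousOn hc
  have hb : ∀ x ∈ closedBall (0 : E) 1, ‖fderiv ℝ h x‖ ≤ max C 1 :=
    fun x hx => (hC x hx).trans (le_max_left _ _)
  exact ⟨max C 1, by positivity, hb, fun x hx y hy =>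
    (convex_closedBall (0 : E) 1).norm_image_sub_le_of_norm_fderiv_le
      (fun z hz => (hd z hz).differentiableAt one_ne_zero) hb hx hy⟩

variable [MeasurableSpace E] [BorelSpace E]

/-- A small perturbation of the identity that fixes the unit sphere and preserves the closed ball
is a diffeomorphism of the open ball, so its Jacobian integrates to the volume. -/
theorem exists_integral_det_eq_volume (hd : ∀ x ∈ closedBall (0 : E) 1, ContDiffAt ℝ 1 h x)
    (h0 : ∀ x, ‖x‖ = 1 → h x = 0) (hle : ∀ x, ‖x‖ ≤ 1 → ‖x + h x‖ ≤ 1) :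
    ∃ ε : ℝ, 0 < ε ∧ ∀ t ∈ Icc 0 ε,
      ∫ x in ball (0 : E) 1, (1 + t • fderiv ℝ h x : E →L[ℝ] E).det =
        (volume : Measure E).real (ball 0 1) := by
  obtain ⟨C, hC, hb, hlip⟩ := exists_lipschitz_of_contDiffAt_closedBall hd
  -- This bound gives both `t < 1` (ball preserved) and `t * C < 1` (injectivity, positive
  -- Jacobian).
  refine ⟨1 / (C + 1), by positivity, fun t ht => ?_⟩
  have ht0 := ht.1
  have htC : t * (C + 1) ≤ 1 := (le_div_iff₀ (by positivity)).1 ht.2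
  have ht1 : t < 1 := by
    by_contra! h
    nlinarith
  have htC' : t * C < 1 := by
    by_contra! h
    nlinarith
  set g : E → E := fun x => x + t • h x with hg
  have hdet : ∀ x ∈ ball (0 : E) 1, 0 < (1 + t • fderiv ℝ h x : E →L[ℝ] E).det := fun x hx => by
    refine det_one_add_pos_of_norm_lt_one _ ?_
    rw [norm_smul, Real.norm_of_nonneg ht0]
    exact (mul_le_mul_of_nonneg_left (hb x (ball_subset_closedBall hx)) ht0).trans_lt htC'
  have hgd : ∀ x ∈ closedBall (0 : E) 1,
      HasStrictFDerivAt g (1 + t • fderiv ℝ h x : E →L[ℝ] E) x := fun x hx =>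
    (hasStrictFDerivAt_id x).add (((hd x hx).hasStrictFDerivAt one_ne_zero).const_smul t)
  have hinj : InjOn g (closedBall (0 : E) 1) := by
    intro x hx y hy hxy
    have h1 : y - x = -(t • (h y - h x)) := by
      have : x + t • h x = y + t • h y := hxy
      rw [smul_sub, neg_sub, sub_eq_sub_iff_add_eq_add, ← this, add_comm]
    have h2 : ‖y - x‖ ≤ t * (C * ‖y - x‖) := by
      conv_lhs => rw [h1, norm_neg, norm_smul, Real.norm_of_nonneg ht0]
      exact mul_le_mul_of_nonneg_left (hlip x hx y hy) ht0
    have h3 : ‖y - x‖ = 0 := by nlinarith [norm_nonneg (y - x)]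
    exact (sub_eq_zero.1 (norm_eq_zero.1 h3)).symm
  have hmaps : ∀ x ∈ ball (0 : E) 1, g x ∈ ball (0 : E) 1 := fun x hx => by
    rw [mem_ball_zero_iff] at hx ⊢
    have h1 : g x = (1 - t) • x + t • (x + h x) := by
      simp only [hg]
      module
    have h2 := hle x hx.le
    calc ‖g x‖ ≤ (1 - t) * ‖x‖ + t * ‖x + h x‖ := by
          rw [h1]
          refine (norm_add_le _ _).trans_eq ?_
          rw [norm_smul, norm_smul, Real.norm_of_nonneg ht0, Real.norm_of_nonneg (by linarith)]
      _ < 1 := by nlinarith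
  have hopen : IsOpen (g '' ball (0 : E) 1) := by
    rw [isOpen_iff_mem_nhds]
    rintro _ ⟨x, hx, rfl⟩
    have h1 := hgd x (ball_subset_closedBall hx)
    have h2 : HasStrictFDerivAt g
        ((1 + t • fderiv ℝ h x : E →L[ℝ] E).toContinuousLinearEquivOfDetNeZero
          (hdet x hx).ne' : E →L[ℝ] E) x := by simpa using h1
    rw [← h2.map_nhds_eq_of_equiv]
    exact image_mem_map (isOpen_ball.mem_nhds hx)
  have hcomp : IsCompact (g '' closedBall (0 : E) 1) :=
    (isCompact_closedBall _ _).image_of_continuousOn fun x hx =>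
      (hgd x hx).hasFDerivAt.continuousAt.continuousWithinAt
  -- The image is open, and relatively closed in the connected ball: a limit point is `g x` with
  -- `‖x‖ ≤ 1`, and `‖x‖ = 1` would put `g x = x` on the sphere.
  have himage : g '' ball (0 : E) 1 = ball 0 1 := by
    refine Subset.antisymm (by rintro _ ⟨x, hx, rfl⟩; exact hmaps x hx) ?_
    refine (convex_ball (0 : E) 1).isPreconnected.subset_of_closure_inter_subset hopen
      ⟨g 0, hmaps 0 (by simp), 0, by simp, rfl⟩ ?_
    rintro y ⟨hy, hyb⟩
    obtain ⟨x, hx, rfl⟩ :=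
      closure_minimal (image_mono ball_subset_closedBall) hcomp.isClosed hy
    rw [mem_closedBall_zero_iff] at hx
    rcases hx.lt_or_eq with hx | hx
    · exact ⟨x, by simpa using hx, rfl⟩
    · have : g x = x := by simp [hg, h0 x hx]
      rw [this, mem_ball_zero_iff, hx] at hyb
      exact absurd hyb (lt_irrefl _)
  have hcv := integral_image_eq_integral_abs_det_fderiv_smul (volume : Measure E)
    measurableSet_ball
    (fun x hx => (hgd x (ball_subset_closedBall hx)).hasFDerivAt.hasFDerivWithinAt)
    (hinj.mono ball_subset_closedBall) (fun _ => (1 : ℝ))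
  rw [himage] at hcv
  simp only [smul_eq_mul, mul_one, integral_const, measureReal_restrict_apply_univ] at hcv
  rw [hcv]
  refine setIntegral_congr_fun measurableSet_ball fun x hx => ?_
  exact (abs_of_pos (hdet x hx)).symm

/-- A `C¹` map fixing the sphere and preserving the ball has Jacobian integral the volume. -/
theorem integral_det_fderiv_eq_volume (hd : ∀ x ∈ closedBall (0 : E) 1, ContDiffAt ℝ 1 h x)
    (h0 : ∀ x, ‖x‖ = 1 → h x = 0) (hle : ∀ x, ‖x‖ ≤ 1 → ‖x + h x‖ ≤ 1) :
    ∫ x in ball (0 : E) 1, (1 + fderiv ℝ h x : E →L[ℝ] E).det =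
      (volume : Measure E).real (ball 0 1) := by
  obtain ⟨ε, hε, hint⟩ := exists_integral_det_eq_volume hd h0 hle
  set n := Module.finrank ℝ E
  let s := Finset.range (n + 1)
  let v : ℕ → ℝ := fun i => ε * i / (n + 1)
  have hv : Set.InjOn v s := by
    intro i _ j _ hij
    have : ε * i / (n + 1) = ε * j / (n + 1) := hij
    field_simp at this
    exact_mod_cast this
  have hvI : ∀ i ∈ s, v i ∈ Icc 0 ε := fun i hi => by
    have h1 : (i : ℝ) ≤ n + 1 := by exact_mod_cast (Finset.mem_range.1 hi).le
    refine ⟨by positivity, ?_⟩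
    rw [div_le_iff₀ (by positivity)]
    exact mul_le_mul_of_nonneg_left h1 hε.le
  -- Lagrange interpolation at `n + 1` nodes in `[0, ε]` extrapolates to `t = 1` with coefficients
  -- independent of `A`, hence of `x` under the integral.
  have key : ∀ A : E →L[ℝ] E, (1 + A : E →L[ℝ] E).det =
      ∑ i ∈ s, (1 + v i • A : E →L[ℝ] E).det * (Lagrange.basis s v i).eval 1 := fun A => by
    obtain ⟨p, hp, hpt⟩ := exists_polynomial_det_one_add_smul A
    have h1 := congrArg (Polynomial.eval 1)
      (Lagrange.eq_interpolate hv (f := p) (by simpa [s] using hp))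
    rw [← hpt 1, one_smul] at h1
    rw [h1, Lagrange.interpolate_apply, Polynomial.eval_finsetSum]
    exact Finset.sum_congr rfl fun i _ => by rw [Polynomial.eval_mul, Polynomial.eval_C, hpt]
  have hcont : ∀ t : ℝ, IntegrableOn (fun x => (1 + t • fderiv ℝ h x : E →L[ℝ] E).det)
      (ball (0 : E) 1) := fun t => by
    refine (ContinuousOn.integrableOn_compact (isCompact_closedBall (0 : E) 1)
      fun x hx => ?_).mono_set ball_subset_closedBall
    refine (ContinuousLinearMap.continuous_det.continuousAt.comp (x := x) ?_).continuousWithinAt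
    exact continuousAt_const.add (((hd x hx).continuousAt_fderiv one_ne_zero).const_smul t)
  rw [setIntegral_congr_fun measurableSet_ball fun x _ => key (fderiv ℝ h x)]
  rw [integral_finsetSum _ fun i _ => (hcont (v i)).mul_const _]
  have h1 : ∑ i ∈ s, (Lagrange.basis s v i).eval 1 = 1 := by
    rw [← Polynomial.eval_finsetSum, Lagrange.sum_basis hv (by simp [s]), Polynomial.eval_one]
  rw [Finset.sum_congr rfl fun i hi => by rw [integral_mul_const, hint _ (hvI i hi)],
    ← Finset.mul_sum, h1, mul_one]

/-- There is no `C¹` retraction of the closed unit ball onto the sphere. -/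
theorem no_contDiff_retraction {r : E → E}
    (hd : ∀ x ∈ closedBall (0 : E) 1, ContDiffAt ℝ 1 r x)
    (hfix : ∀ x, ‖x‖ = 1 → r x = x) (hr : ∀ x, ‖x‖ ≤ 1 → ‖r x‖ = 1) : False := by
  have key := integral_det_fderiv_eq_volume (h := fun x => r x - x)
    (fun x hx => (hd x hx).sub contDiffAt_id) (fun x hx => by simp [hfix x hx])
    (fun x hx => by simp [hr x hx])
  have hpos : 0 < (volume : Measure E).real (ball 0 1) :=
    ENNReal.toReal_pos (measure_ball_pos _ _ one_pos).ne' measure_ball_lt_top.ne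
  rw [← key, setIntegral_congr_fun (g := fun _ => (0 : ℝ)) measurableSet_ball, integral_zero] at hpos
  · exact lt_irrefl _ hpos
  intro x hx
  have hxc := ball_subset_closedBall hx
  have hrd := (hd x hxc).differentiableAt one_ne_zero
  have h1 : (1 + fderiv ℝ (fun x => r x - x) x : E →L[ℝ] E) = fderiv ℝ r x := by
    rw [fderiv_fun_sub hrd differentiableAt_fun_id, fderiv_fun_id]
    exact add_sub_cancel _ _
  show (1 + fderiv ℝ (fun x => r x - x) x : E →L[ℝ] E).det = 0
  rw [h1]
  by_contra hne
  -- Differentiating `‖r‖ ^ 2 = 1` makes the range of the derivative orthogonal to `r x ≠ 0`, so the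
  -- derivative is not surjective.
  have horth : ∀ v, inner ℝ (r x) (fderiv ℝ r x v) = 0 := fun v => by
    have h2 : (fun y => ‖r y‖ ^ 2) =ᶠ[𝓝 x] fun _ => (1 : ℝ) := by
      filter_upwards [isOpen_ball.mem_nhds hx] with y hy
      rw [hr y (by simpa using (mem_ball_zero_iff.1 hy).le), one_pow]
    have h3 := (hrd.hasFDerivAt.norm_sq).unique
      ((hasFDerivAt_const (1 : ℝ) x).congr_of_eventuallyEq h2)
    have h4 := congrArg (fun L => L v) h3
    simpa using h4
  have hsurj := ((fderiv ℝ r x).toContinuousLinearEquivOfDetNeZero hne).surjective (r x)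
  obtain ⟨v, hv⟩ := hsurj
  have h5 : fderiv ℝ r x v = r x := hv
  have h6 := horth v
  rw [h5, real_inner_self_eq_norm_sq, hr x (by simpa using hxc)] at h6
  norm_num at h6

/-- Brouwer's fixed point theorem for `C¹` self-maps of the closed unit ball. -/
theorem exists_fixedPoint_of_contDiff {g : E → E} (hg : ContDiff ℝ 1 g)
    (hle : ∀ x, ‖x‖ ≤ 1 → ‖g x‖ ≤ 1) : ∃ x, ‖x‖ ≤ 1 ∧ g x = x := by
  by_contra! hne
  -- The ray from `g x` through `x` meets the sphere at `x + c • (x - g x)`, where `q c² + 2 a c = 1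
  -- - ‖x‖²`; `D` is a quarter of the discriminant and the larger root is taken. `D > 0` keeps the
  -- root `C¹`, and `a > 0` on the sphere makes it `0` there.
  set a : E → ℝ := fun x => inner ℝ x (x - g x) with ha
  set q : E → ℝ := fun x => ‖x - g x‖ ^ 2 with hq
  set D : E → ℝ := fun x => a x ^ 2 + q x * (1 - ‖x‖ ^ 2) with hD
  have hqpos : ∀ x, ‖x‖ ≤ 1 → 0 < q x := fun x hx =>
    pow_pos (norm_pos_iff.2 (sub_ne_zero.2 (hne x hx).symm)) 2
  have hapos : ∀ x, ‖x‖ = 1 → 0 < a x := fun x hx => by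
    have h1 := hqpos x hx.le
    have h2 := hle x hx.le
    have h3 : q x = ‖x‖ ^ 2 - 2 * inner ℝ x (g x) + ‖g x‖ ^ 2 := norm_sub_sq_real x (g x)
    have h4 : a x = ‖x‖ ^ 2 - inner ℝ x (g x) := by
      simp only [ha, inner_sub_right, real_inner_self_eq_norm_sq]
    rw [hx] at h3 h4
    nlinarith [norm_nonneg (g x)]
  have hDpos : ∀ x, ‖x‖ ≤ 1 → 0 < D x := fun x hx => by
    rcases hx.lt_or_eq with h1 | h1
    · have h2 : 0 < 1 - ‖x‖ ^ 2 := by nlinarith [norm_nonneg x]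
      exact add_pos_of_nonneg_of_pos (sq_nonneg _) (mul_pos (hqpos x hx) h2)
    · simp only [hD, h1]
      have := hapos x h1
      nlinarith
  have hu : ContDiff ℝ 1 fun x => x - g x := contDiff_id.sub hg
  have hac : ContDiff ℝ 1 a := contDiff_id.inner ℝ hu
  have hqc : ContDiff ℝ 1 q := hu.norm_sq ℝ
  have hDc : ContDiff ℝ 1 D :=
    (hac.pow 2).add (hqc.mul (contDiff_const.sub (contDiff_id.norm_sq ℝ)))
  refine no_contDiff_retraction (r := fun x => x + ((-a x + √(D x)) / q x) • (x - g x))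
    (fun x hx => ?_) (fun x hx => ?_) fun x hx => ?_
  · rw [mem_closedBall_zero_iff] at hx
    exact contDiffAt_id.add (((hac.contDiffAt.neg.add
      (hDc.contDiffAt.sqrt (hDpos x hx).ne')).div hqc.contDiffAt (hqpos x hx).ne').smul
        hu.contDiffAt)
  · have h1 : D x = a x ^ 2 := by simp [hD, hx]
    simp [h1, Real.sqrt_sq (hapos x hx).le]
  · have hq0 := (hqpos x hx).ne'
    set c := (-a x + √(D x)) / q x with hc
    have h1 : q x * c = -a x + √(D x) := mul_div_cancel₀ _ hq0
    have h2 : √(D x) ^ 2 = a x ^ 2 + q x * (1 - ‖x‖ ^ 2) := Real.sq_sqrt (hDpos x hx).le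
    have h3 : ‖x + c • (x - g x)‖ ^ 2 = ‖x‖ ^ 2 + 2 * (c * a x) + c ^ 2 * q x := by
      rw [norm_add_sq_real, real_inner_smul_right, norm_smul, mul_pow, Real.norm_eq_abs, sq_abs]
    have h4 : ‖x + c • (x - g x)‖ ^ 2 = 1 := by
      rw [h3]
      refine mul_left_cancel₀ hq0 ?_
      linear_combination (q x * c + 2 * a x - a x + √(D x)) * h1 + h2
    exact (pow_eq_one_iff_of_nonneg (norm_nonneg _) two_ne_zero).1 h4

/-- Brouwer's fixed point theorem for continuous maps with values in the closed unit ball. -/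
theorem exists_fixedPoint_of_norm_le_one {f : E → E} (hf : Continuous f)
    (hle : ∀ x, ‖f x‖ ≤ 1) : ∃ x, f x = x := by
  by_contra! hne
  -- A partition of unity glues local constants into a `C¹` map `g` with `g x` closer to `f x` than
  -- `x` is, so `g` has no fixed point either.
  obtain ⟨g, hg⟩ := exists_contMDiffMap_forall_mem_convex_of_local_const (n := 1)
    (modelWithCornersSelf ℝ E) (M := E) (F := E)
    (t := fun x => closedBall (0 : E) 1 ∩ ball (f x) (dist x (f x)))
    (fun x => (convex_closedBall _ _).inter (convex_ball _ _)) fun x => by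
      refine ⟨f x, ?_⟩
      have h1 : ∀ᶠ y in 𝓝 x, dist (f x) (f y) < dist y (f y) := by
        refine ContinuousAt.eventually_lt (by fun_prop) (by fun_prop) ?_
        rw [dist_self]
        exact dist_pos.2 (hne x).symm
      filter_upwards [h1] with y hy
      exact ⟨mem_closedBall_zero_iff.2 (hle x), hy⟩
  obtain ⟨x, -, hx⟩ := exists_fixedPoint_of_contDiff g.contMDiff.contDiff
    fun x _ => mem_closedBall_zero_iff.1 (hg x).1
  have h2 := (hg x).2
  rw [hx] at h2
  exact lt_irrefl _ (mem_ball.1 h2)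

end Brouwer

/-- A continuous self-map of `ℝⁿ` with bounded range has a fixed point. -/
theorem exists_fixedPoint_of_bounded {ι : Type*} [Fintype ι] {f : (ι → ℝ) → ι → ℝ}
    (hf : Continuous f) {R : ℝ} (hR : ∀ x, ‖f x‖ ≤ R) : ∃ x, f x = x := by
  let e := EuclideanSpace.equiv ι ℝ
  obtain ⟨C, hC⟩ := (isCompact_closedBall (0 : ι → ℝ) R).exists_bound_of_continuousOn
    e.symm.continuous.continuousOn
  -- `C` bounds the Euclidean norm on the sup-norm ball of radius `R`; rescaling by `c` brings the
  -- range into the Euclidean unit ball.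
  set c : ℝ := max C 1
  have hc : 0 < c := by positivity
  obtain ⟨x, hx⟩ := exists_fixedPoint_of_norm_le_one
    (f := fun x : EuclideanSpace ℝ ι => c⁻¹ • e.symm (f (e (c • x)))) (by fun_prop) fun x => by
      have h1 := hC (f (e (c • x))) (Metric.mem_closedBall.2 (by simpa using hR _))
      rw [norm_smul, norm_inv, Real.norm_of_nonneg hc.le, inv_mul_le_one₀ hc]
      exact h1.trans (le_max_left _ _)
  refine ⟨e (c • x), ?_⟩
  have h2 : e.symm (f (e (c • x))) = c • x := by
    conv_rhs => rw [← hx, smul_inv_smul₀ hc.ne']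
  rw [← e.apply_symm_apply (f (e (c • x))), h2]

namespace SelectedGrid

/-! ### The monotone cone and its projection -/

theorem isClosed_cone (K : ℕ) (X : ℝ) : IsClosed (cone K X) := by
  have : cone K X = (⋂ k, {x | x k ∈ Set.Icc (-X) X}) ∩
      ⋂ i, ⋂ j, ⋂ (_ : i ≤ j), {x : Fin K → ℝ | x j ≤ x i} := by
    ext x
    simp [cone, Antitone]
  rw [this]
  exact (isClosed_iInter fun k => isClosed_Icc.preimage (continuous_apply k)).inter
    (isClosed_iInter fun i => isClosed_iInter fun j => isClosed_iInter fun _ =>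
      isClosed_le (continuous_apply j) (continuous_apply i))

theorem isCompact_cone (K : ℕ) (X : ℝ) : IsCompact (cone K X) :=
  (isCompact_univ_pi fun _ : Fin K => isCompact_Icc).of_isClosed_subset (isClosed_cone K X)
    fun _ hx k _ => hx.1 k

theorem convex_cone (K : ℕ) (X : ℝ) : Convex ℝ (cone K X) := by
  intro x hx y hy s t hs ht hst
  refine ⟨fun k => convex_Icc (-X) X (hx.1 k) (hy.1 k) hs ht hst, fun i j hij => ?_⟩
  exact add_le_add (mul_le_mul_of_nonneg_left (hx.2 hij) hs)
    (mul_le_mul_of_nonneg_left (hy.2 hij) ht)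

theorem zero_mem_cone (K : ℕ) {X : ℝ} (hX : 0 < X) : (0 : Fin K → ℝ) ∈ cone K X :=
  ⟨fun _ => ⟨neg_nonpos.2 hX.le, hX.le⟩, fun _ _ _ => le_rfl⟩

variable {K : ℕ}

theorem continuous_wdist (omega : Fin K → ℝ) :
    Continuous fun p : (Fin K → ℝ) × (Fin K → ℝ) => wdist omega p.1 p.2 := by
  unfold wdist
  fun_prop

/-- The projection is continuous: its graph is closed and its range lies in a compact set. -/
theorem continuous_isotonicProj (omega : Fin K → ℝ) (homega : ∀ k, 0 < omega k)
    {X : ℝ} (hX : 0 < X) : Continuous (isotonicProj omega X) := by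
  rw [continuous_iff_continuousAt]
  intro y
  refine (isCompact_cone K X).tendsto_nhds_of_unique_mapClusterPt
    (.of_forall fun y' => (isotonicProj_spec omega homega hX y').1) fun z hz hcl => ?_
  refine (existsUnique_isotonicProj omega homega hX y).unique ⟨hz, fun z' hz' => ?_⟩
    (isotonicProj_spec omega homega hX y)
  -- Along a sequence `u n → y` whose projections tend to `z`, the minimality inequalities pass to
  -- the limit.
  obtain ⟨u, huz, hu⟩ := hcl.exists_seq_tendsto
  have hW := continuous_wdist omega
  exact le_of_tendsto_of_tendsto' ((hW.tendsto (y, z)).comp (hu.prodMk_nhds huz))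
    ((hW.tendsto (y, z')).comp (hu.prodMk_nhds tendsto_const_nhds))
    fun n => (isotonicProj_spec omega homega hX (u n)).2 z' hz'

/-! ### Continuity of the raw response -/

variable (b : Benchmark) (d : Discretization K)

theorem continuous_signProb (hF : Continuous b.F)
    (hf : Continuous fun p : ℝ × I => b.f p.1 p.2) (hw : ∀ k, Continuous (d.w k)) :
    Continuous fun p : (Fin K → ℝ) × I => signProb b d p.1 p.2 := by
  have h1 : ∀ m, Continuous fun p : (Fin K → ℝ) × I => b.f m p.2 := fun m =>
    hf.comp (continuous_const.prodMk continuous_snd)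
  unfold signProb
  have h2 := fun k => hF.comp ((continuous_apply k).comp
    (continuous_fst : Continuous fun p : (Fin K → ℝ) × I => p.1))
  have h3 := fun k => (hw k).comp (continuous_snd : Continuous fun p : (Fin K → ℝ) × I => p.2)
  exact (continuous_subtype_val.comp continuous_snd).mul (continuous_finsetSum _ fun k _ =>
    (h3 k).mul ((continuous_const.sub (h2 k)).mul (h1 (d.m k))))

theorem continuous_binomPoint (n j : ℕ) : Continuous (binomPoint n j) := by
  unfold binomPoint
  fun_prop

theorem continuous_binomTail (n t : ℕ) : Continuous (binomTail n t) :=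
  continuous_finsetSum _ fun j _ => continuous_binomPoint n j

/-- The Bayes denominator does not depend on the cutoffs, so it may vanish without harm: dividing by
a constant is continuous even when it is `0`. -/
theorem continuous_posteriorMean [IsFiniteMeasure b.prior]
    (hf : Continuous fun p : ℝ × I => b.f p.1 p.2) {g : (Fin K → ℝ) → I → ℝ}
    (hg : Continuous fun p : (Fin K → ℝ) × I => g p.1 p.2) (m : ℝ) :
    Continuous fun x => posteriorMean b (g x) m := by
  have h1 : Continuous fun p : (Fin K → ℝ) × I => g p.1 p.2 * b.f m p.2 :=
    hg.mul (hf.comp (continuous_const.prodMk continuous_snd))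
  have h2 := continuous_parametric_integral_of_continuous (μ := b.prior)
    (f := fun x θ => g x θ * b.f m θ) h1 isCompact_univ
  simp only [Measure.restrict_univ] at h2
  exact h2.div_const _

theorem continuous_rawResponse [IsFiniteMeasure b.prior] (hF : Continuous b.F)
    (hf : Continuous fun p : ℝ × I => b.f p.1 p.2) (hw : ∀ k, Continuous (d.w k))
    (heps : 0 < d.eps) : Continuous (rawResponse b d) := by
  have hα := continuous_signProb b d hF hf hw
  refine continuous_pi fun k => ?_
  have h1 : Continuous fun x => piv b d x k :=
    continuous_posteriorMean b hf ((continuous_binomPoint _ _).comp hα) _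
  have h2 : Continuous fun x => pPlus b d x k :=
    continuous_posteriorMean b hf ((continuous_binomTail _ _).comp hα) _
  have h3 : Continuous fun x => pZero b d x k :=
    continuous_posteriorMean b hf ((continuous_binomTail _ _).comp hα) _
  unfold rawResponse clip
  refine continuous_const.max (continuous_const.min (Continuous.div ?_ (h2.max continuous_const)
    fun x => (heps.trans_le (le_max_right _ _)).ne'))
  fun_prop

end SelectedGrid

/-! ### The fixed point -/

theorem mainTheorem11 {K : ℕ} (b : SelectedGrid.Benchmark) (d : SelectedGrid.Discretization K)
    (hT : 1 ≤ b.T) (hTN : b.T < b.N)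
    (hlaw : IsProbabilityMeasure b.typeLaw) (hprior : IsProbabilityMeasure b.prior)
    (hF : Continuous b.F)
    (hf_nonneg : ∀ m θ, 0 ≤ b.f m θ) (hf_int : ∀ θ, ∫ m, b.f m θ = 1)
    (hf : Continuous fun p : ℝ × I => b.f p.1 p.2)
    (hm : StrictMono d.m) (hw : ∀ k, Continuous (d.w k))
    (heps : 0 < d.eps) (hX : 0 < d.X) (homega : ∀ k, 0 < d.omega k) :
    ContinuousOn (SelectedGrid.projResponse b d) (SelectedGrid.cone K d.X) ∧
      Set.MapsTo (SelectedGrid.projResponse b d)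
        (SelectedGrid.cone K d.X) (SelectedGrid.cone K d.X) ∧
      (SelectedGrid.cone K d.X).Nonempty ∧ IsCompact (SelectedGrid.cone K d.X) ∧
      Convex ℝ (SelectedGrid.cone K d.X) ∧
      ∃ x ∈ SelectedGrid.cone K d.X, SelectedGrid.projResponse b d x = x := by
  have hcont : Continuous (SelectedGrid.projResponse b d) :=
    (SelectedGrid.continuous_isotonicProj d.omega homega hX).comp
      (SelectedGrid.continuous_rawResponse b d hF hf hw heps)
  have hmem : ∀ x, SelectedGrid.projResponse b d x ∈ SelectedGrid.cone K d.X := fun x =>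
    (SelectedGrid.isotonicProj_spec d.omega homega hX _).1
  -- The box constraint of the cone is exactly a sup-norm bound by `X`.
  obtain ⟨x, hx⟩ := exists_fixedPoint_of_bounded hcont (R := d.X) fun x =>
    (pi_norm_le_iff_of_nonneg hX.le).2 fun k => abs_le.2 ((hmem x).1 k)
  exact ⟨hcont.continuousOn, fun x _ => hmem x, ⟨0, SelectedGrid.zero_mem_cone K hX⟩,
    SelectedGrid.isCompact_cone K d.X, SelectedGrid.convex_cone K d.X, x, hx ▸ hmem x, hx⟩
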